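/- Let $q$ be a power of an odd prime, let $R=\mathbb F_q+v\mathbb F_q+v^2\mathbb F_q=\mathbb F_q[v]/\langle v^3-v\rangle$, with the orthogonal idempotents $v_1=1-v^2$, $v_2=\frac{v+v^2}{2}$, $v_3=\frac{v^2-v}{2}$, so that every $r(x)\in R[x]$ is uniquely $r=\sum_{i=1}^3 r_{v_i}v_i$ with $r_{v_i}\in\mathbb F_q[x]$. Let $m,n\ge 1$ and $l=\operatorname{lcm}(m,n)$. A double cyclic code of length $(m,n)$ is an $R$-submodule $C$ of $R^m\times R^n$ closed under the simultaneous cyclic shift of both blocks; via $c\mapsto\bigl(\sum_i c^1_ix^i\,\big|\,\sum_j c^2_jx^j\bigr)$ it is an $R[x]$-submodule of $R[x]/\langle x^m-1\rangle\times R[x]/\langle x^n-1\rangle$. Its dual is $C^\perp=\{d:\langle d,c\rangle=0\ \forall c\in C\}$, where $\langle d,c\rangle=\sum_i d^1_ic^1_i+\sum_j d^2_jc^2_j$. The code $C$ is separable if it is the direct product of its two coordinate projections. Writing a double cyclic code as $C=\langle(\iota|0),(\ell|\theta)\rangle$ means that these elements generate it over $R[x]$, that $\iota_{v_i}\mid x^m-1$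 and $\theta_{v_i}\mid x^n-1$ for all $i$, and that $\iota$ generates the ideal $\{a:(a|0)\in C\}$ of $R[x]/\langle x^m-1\rangle$. For nonzero $f\in\mathbb F_q[x]$ let $\operatorname{lc}(f)$ be the coefficient of its lowest-degree nonzero term and $f^*=\operatorname{lc}(f)^{-1}x^{\deg f}f(x^{-1})$ its monic reciprocal; put $0^*=0$; and write $\gcd^*(f,g)=(\gcd(f,g))^*$. **Theorem 2.** Let $C=\langle(\iota|0),(\ell|\theta)\rangle$ be a double cyclic code of length $(m,n)$ over $R$, and let $C^\perp=\langle(\bar\iota|0),(\bar\ell|\bar\theta)\rangle$, where the generators of $C^\perp$ are normalized: for each $i$, $\bar\iota_{v_i}$ and $\bar\theta_{v_i}$ are monic and $\deg\bar\ell_{v_i}<\deg\bar\iota_{v_i}$ (with $\deg 0=-\infty$). Then, all the divisions below being exact: (1) $\displaystyle\bar\iota=\sum_{i=1}^3\frac{x^m-1}{\gcd^*(\iota_{v_i},\ell_{v_i})}\,v_i$; (2) $\displaystyle\bar\theta=\sum_{i=1}^3\frac{(x^n-1)\gcd^*(\iota_{v_i},\ell_{v_i})}{\iota^*_{v_i}\theta^*_{v_i}}\,v_i$;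 (3) $\displaystyle\bar\ell=\rho\sum_{i=1}^3\frac{x^m-1}{\iota^*_{v_i}}\,v_i$ for some $\rho=\sum_i\rho_{v_i}v_i\in R[x]$, where $\rho=0$ if $C$ is separable, and otherwise, for each $i$, $\ell^*_{v_i}/\gcd^*(\iota_{v_i},\ell_{v_i})$ is invertible modulo $\iota^*_{v_i}/\gcd^*(\iota_{v_i},\ell_{v_i})$ and $\rho_{v_i}$ is the remainder of $$-\frac{\operatorname{lc}(\theta_{v_i})}{\operatorname{lc}(\ell_{v_i})}\,x^{\,l-\deg\theta_{v_i}+\deg\ell_{v_i}}\left(\frac{\ell^*_{v_i}}{\gcd^*(\iota_{v_i},\ell_{v_i})}\right)^{-1}$$ modulo $\iota^*_{v_i}/\gcd^*(\iota_{v_i},\ell_{v_i})$. (If $\ell_{v_i}=0$, this modulus is $1$ and $\rho_{v_i}=0$.) -/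

import Mathlib

open Polynomial

noncomputable section

namespace DoubleCyclic

/-- The ring `R = F + v F + v ^ 2 F` with `v ^ 3 = v`, that is `F[X] / (X ^ 3 - X)`. -/
abbrev CoeffRing (F : Type*) [Field F] : Type _ := AdjoinRoot (X ^ 3 - X : F[X])

/-- The element `v` of `R`. -/
def v (F : Type*) [Field F] : CoeffRing F := AdjoinRoot.root (X ^ 3 - X : F[X])

/-- The idempotents `v₁ = 1 - v ^ 2`, `v₂ = (v + v ^ 2) / 2`, `v₃ = (v ^ 2 - v) / 2`. -/
def idem (F : Type*) [Field F] : Fin 3 → CoeffRing F :=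
  ![1 - v F ^ 2, (2⁻¹ : F) • (v F + v F ^ 2), (2⁻¹ : F) • (v F ^ 2 - v F)]

/-- The polynomial `∑ᵢ fᵢ(x) vᵢ` over `R` with components `fᵢ ∈ F[x]`. -/
def ofComponents {F : Type*} [Field F] (f : Fin 3 → F[X]) : (CoeffRing F)[X] :=
  ∑ i, (f i).map (algebraMap F (CoeffRing F)) * C (idem F i)

/-- The words `(c¹ | c²)` of length `(m, n)`, that is `R ^ m × R ^ n`. -/
abbrev Word (F : Type*) [Field F] (m n : ℕ) : Type _ :=
  (Fin m → CoeffRing F) × (Fin n → CoeffRing F)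

/-- The simultaneous cyclic shift of both blocks to the right. -/
def shift {F : Type*} [Field F] {m n : ℕ} (c : Word F m n) : Word F m n :=
  (fun i => c.1 ((finRotate m).symm i), fun j => c.2 ((finRotate n).symm j))

/-- A linear code of length `m + n` is double cyclic if it is closed under the shift. -/
def IsDoubleCyclic {F : Type*} [Field F] {m n : ℕ}
    (K : Submodule (CoeffRing F) (Word F m n)) : Prop :=
  ∀ c ∈ K, shift c ∈ K

/-- The inner product on `R ^ m × R ^ n`. -/
def innerProd {F : Type*} [Field F] {m n : ℕ} (c d : Word F m n) : CoeffRing F :=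
  (∑ i, c.1 i * d.1 i) + ∑ j, c.2 j * d.2 j

/-- The dual code. -/
def dualCode {F : Type*} [Field F] {m n : ℕ} (K : Submodule (CoeffRing F) (Word F m n)) :
    Submodule (CoeffRing F) (Word F m n) where
  carrier := {d | ∀ c ∈ K, innerProd d c = 0}
  zero_mem' := by
    intro c _
    simp [innerProd]
  add_mem' := by
    intro a b ha hb c hc
    have h1 := ha c hc
    have h2 := hb c hc
    simp only [innerProd] at h1 h2
    simp only [innerProd, Prod.fst_add, Prod.snd_add, Pi.add_apply, add_mul,
      Finset.sum_add_distrib]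
    linear_combination h1 + h2
  smul_mem' := by
    intro r a ha c hc
    have h1 := ha c hc
    simp only [innerProd] at h1
    simp only [innerProd, Prod.smul_fst, Prod.smul_snd, Pi.smul_apply, smul_eq_mul, mul_assoc,
      ← Finset.mul_sum]
    linear_combination r * h1

/-- A code is separable if it is the direct product of its two coordinate projections. -/
def IsSeparableCode {F : Type*} [Field F] {m n : ℕ}
    (K : Submodule (CoeffRing F) (Word F m n)) : Prop :=
  K = (K.map (LinearMap.fst (CoeffRing F) (Fin m → CoeffRing F) (Fin n → CoeffRing F))).prod
      (K.map (LinearMap.snd (CoeffRing F) (Fin m → CoeffRing F) (Fin n → CoeffRing F)))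

/-- The ring `R[x] / (x ^ m - 1)`. -/
abbrev CyclicRing (F : Type*) [Field F] (m : ℕ) : Type _ :=
  (CoeffRing F)[X] ⧸ Ideal.span {(X ^ m - 1 : (CoeffRing F)[X])}

/-- The class of a polynomial modulo `x ^ m - 1`. -/
abbrev toCyclic {F : Type*} [Field F] (m : ℕ) (f : (CoeffRing F)[X]) : CyclicRing F m :=
  Ideal.Quotient.mk (Ideal.span {(X ^ m - 1 : (CoeffRing F)[X])}) f

/-- The identification of `R ^ m × R ^ n` with `R[x] / (x ^ m - 1) × R[x] / (x ^ n - 1)`. -/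
def wordToPoly {F : Type*} [Field F] {m n : ℕ} (c : Word F m n) :
    CyclicRing F m × CyclicRing F n :=
  (toCyclic m (∑ i : Fin m, C (c.1 i) * X ^ (i : ℕ)),
    toCyclic n (∑ j : Fin n, C (c.2 j) * X ^ (j : ℕ)))

/-- `K = ⟨(ι | 0), (ℓ | θ)⟩` as an `R[x]`-module, where `ι = ∑ᵢ ιᵢ vᵢ` and so on, with
`ιᵢ ∣ x ^ m - 1` and `θᵢ ∣ x ^ n - 1`, and where `ι` generates the ideal of all `a` such that
`(a | 0)` lies in `K`. -/
structure IsGeneratedBy {F : Type*} [Field F] {m n : ℕ}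
    (K : Submodule (CoeffRing F) (Word F m n)) (ι ℓ θ : Fin 3 → F[X]) : Prop where
  iota_dvd : ∀ i, ι i ∣ X ^ m - 1
  theta_dvd : ∀ i, θ i ∣ X ^ n - 1
  code_eq : wordToPoly '' (K : Set (Word F m n)) =
    (Submodule.span (CoeffRing F)[X]
      {(toCyclic m (ofComponents ι), (0 : CyclicRing F n)),
        (toCyclic m (ofComponents ℓ), toCyclic n (ofComponents θ))} :
      Set (CyclicRing F m × CyclicRing F n))
  kernel_eq : {a : CyclicRing F m |
      (a, (0 : CyclicRing F n)) ∈ wordToPoly '' (K : Set (Word F m n))} =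
    (Ideal.span {toCyclic m (ofComponents ι)} : Set (CyclicRing F m))

/-- The normalization of the generators `(ι | 0), (ℓ | θ)` that makes them unique: the
components of `ι` and `θ` are monic, and those of `ℓ` are reduced modulo those of `ι`. -/
structure IsNormalized {F : Type*} [Field F] (ι ℓ θ : Fin 3 → F[X]) : Prop where
  iota_monic : ∀ i, (ι i).Monic
  theta_monic : ∀ i, (θ i).Monic
  degree_lt : ∀ i, (ℓ i).degree < (ι i).degree

/-- The monic reciprocal polynomial `f* = lc(f)⁻¹ x ^ (deg f) f(1 / x)`, where `lc(f)` is the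
coefficient of the lowest term of `f`. -/
def recip {F : Type*} [Field F] (f : F[X]) : F[X] :=
  C (f.trailingCoeff)⁻¹ * f.reverse

open Classical in
/-- `gcd*(f, g)`, the monic reciprocal of the greatest common divisor; it does not change
when the greatest common divisor is multiplied by a nonzero constant. -/
def gcdRecip {F : Type*} [Field F] (f g : F[X]) : F[X] :=
  recip (EuclideanDomain.gcd f g)

end DoubleCyclic

end

open DoubleCyclic

/-! The idempotents split `R` into three copies of `F`. A double cyclic code, its dual and its
generators split accordingly, so everything reduces to one component over `F`.

Over `F`, put `l = lcm m n`. Modulo `x^l - 1` the variable is invertible, and `expand F (l - 1)` is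
the substitution `x ↦ 1/x`. Orthogonality of `(a | b)` to all shifts of `(c | d)` becomes the
vanishing modulo `x^l - 1` of `a c(1/x) (x^l - 1)/(x^m - 1) + b d(1/x) (x^l - 1)/(x^n - 1)`
(`IsGeneratedBy.mem_dualCode_iff`). It suffices to test the two generators. Let `g = gcd*(ι, ℓ)`,
`ι* = g ι₁`, `ℓ* = g ℓ₁`, `κ = (x^m - 1)/ι*`. Since `ι` generates the kernel ideal, `x^n - 1 = θ* ι₁
τ` for some `τ` (`exists_recip_factorization`). The dual then consists of the pairs `(κe | τf)` with
`lc(ℓ) e ℓ₁ + lc(θ) f x^T` divisible by `ι₁`, where `T = l - deg θ + deg ℓ`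
(`forall_cyclicOrthogonal_iff`).

In `dual_generators`, `f = 0` gives `ι' = κ ι₁`, the possible `f` give `θ' = τ`, and solving for `e`
at `f = 1` gives `ℓ' = κ ρ`, with `ρ` fixed by the degree bound. -/

namespace DoubleCyclic

/-! ### Reciprocal polynomials and the substitution `x ↦ 1/x` modulo `x^l - 1`. -/

section Reciprocal

variable {F : Type*} [Field F]

theorem C_trailingCoeff_mul_recip (f : F[X]) : C f.trailingCoeff * recip f = f.reverse := by
  rcases eq_or_ne f 0 with rfl | hf
  · simp [recip]
  · rw [recip, ← mul_assoc, ← C_mul, mul_inv_cancel₀ (trailingCoeff_nonzero_iff_nonzero.2 hf), C_1,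
      one_mul]

theorem recip_mul (f g : F[X]) : recip (f * g) = recip f * recip g := by
  rw [recip, recip, recip, reverse_mul_of_domain, trailingCoeff_mul, mul_inv, C_mul]
  ring

theorem monic_recip {f : F[X]} (hf : f ≠ 0) : (recip f).Monic := by
  rw [Monic, recip, leadingCoeff_mul, leadingCoeff_C, reverse_leadingCoeff,
    inv_mul_cancel₀ (trailingCoeff_nonzero_iff_nonzero.2 hf)]

theorem recip_dvd_recip {f g : F[X]} (h : f ∣ g) : recip f ∣ recip g := by
  obtain ⟨k, rfl⟩ := h
  exact ⟨recip k, recip_mul f k⟩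

theorem monic_X_pow_sub_one {m : ℕ} (hm : 0 < m) : (X ^ m - 1 : F[X]).Monic := by
  simpa using monic_X_pow_sub_C (1 : F) hm.ne'

theorem natDegree_X_pow_sub_one (m : ℕ) : (X ^ m - 1 : F[X]).natDegree = m := by
  simpa using natDegree_X_pow_sub_C (n := m) (r := (1 : F))

theorem natDegree_modByMonic_X_pow_sub_one_lt {m : ℕ} (hm : 0 < m) (f : F[X]) :
    (f %ₘ (X ^ m - 1)).natDegree < m := by
  have h := natDegree_modByMonic_lt f (monic_X_pow_sub_one hm) (by
    intro h
    have := congrArg natDegree h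
    rw [natDegree_X_pow_sub_one, natDegree_one] at this
    omega)
  rwa [natDegree_X_pow_sub_one] at h

theorem recip_X_pow_sub_one {m : ℕ} (hm : 0 < m) : recip (X ^ m - 1 : F[X]) = X ^ m - 1 := by
  have h0 : (X ^ m - 1 : F[X]).coeff 0 = -1 := by simp [coeff_X_pow, hm.ne]
  have ht : (X ^ m - 1 : F[X]).trailingCoeff = -1 := by
    rw [trailingCoeff, natTrailingDegree_eq_zero.2 (Or.inr (by rw [h0]; simp)), h0]
  have hr : (X ^ m - 1 : F[X]).reverse = 1 - X ^ m := by
    rw [reverse, natDegree_X_pow_sub_one, reflect_sub, reflect_one]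
    have := reflect_C_mul_X_pow m m (c := (1 : F))
    simp only [C_1, one_mul] at this
    rw [this]
    simp [revAt_le le_rfl]
  rw [recip, ht, hr]
  simp

theorem recip_dvd_X_pow_sub_one {m : ℕ} (hm : 0 < m) {f : F[X]} (hf : f ∣ X ^ m - 1) :
    recip f ∣ X ^ m - 1 := by
  simpa only [recip_X_pow_sub_one hm] using recip_dvd_recip hf

theorem X_pow_sub_one_dvd {m l : ℕ} (h : m ∣ l) : (X ^ m - 1 : F[X]) ∣ X ^ l - 1 := by
  obtain ⟨k, rfl⟩ := h
  simpa [pow_mul] using sub_dvd_pow_sub_pow (X ^ m : F[X]) 1 k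

/-- Modulo `x ^ l - 1` the substitution `x ↦ x ^ (l - 1)` inverts `x`. -/
theorem dvd_X_pow_mul_expand_sub_reflect {l : ℕ} (hl : 0 < l) (N : ℕ) (f : F[X])
    (hf : f.natDegree ≤ N) :
    (X ^ l - 1 : F[X]) ∣ X ^ N * expand F (l - 1) f - reflect N f := by
  refine induction_with_natDegree_le
    (fun f => (X ^ l - 1 : F[X]) ∣ X ^ N * expand F (l - 1) f - reflect N f) N ?_ ?_ ?_ f hf
  · simp
  · intro k c _ hk
    rw [reflect_C_mul_X_pow, revAt_le hk, map_mul, expand_C, map_pow, expand_X, ← pow_mul]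
    have : (X ^ N * (C c * X ^ ((l - 1) * k)) - C c * X ^ (N - k) : F[X])
        = C c * X ^ (N - k) * (X ^ (l * k) - 1) := by
      obtain ⟨s, rfl⟩ := Nat.exists_eq_add_of_le hk
      obtain ⟨l, rfl⟩ := Nat.exists_eq_add_of_le' hl
      simp only [Nat.add_sub_cancel, Nat.add_sub_cancel_left]
      ring
    rw [this]
    exact (X_pow_sub_one_dvd (dvd_mul_right l k)).mul_left _
  · intro f g _ _ hf hg
    rw [map_add, reflect_add]
    convert dvd_add hf hg using 1
    ring

theorem dvd_X_pow_mul_expand_sub_recip {l : ℕ} (hl : 0 < l) (f : F[X]) :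
    (X ^ l - 1 : F[X]) ∣
      X ^ f.natDegree * expand F (l - 1) f - C f.trailingCoeff * recip f := by
  rw [C_trailingCoeff_mul_recip]
  exact dvd_X_pow_mul_expand_sub_reflect hl _ f le_rfl

theorem isCoprime_X_pow {l : ℕ} (hl : 0 < l) {p : F[X]} (hp : p ∣ X ^ l - 1) (k : ℕ) :
    IsCoprime p (X ^ k) := by
  refine IsCoprime.pow_right (IsCoprime.of_isCoprime_of_dvd_left ?_ hp)
  obtain ⟨l, rfl⟩ := Nat.exists_eq_add_of_le' hl
  exact ⟨-1, X ^ l, by ring⟩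

/-- Modulo a divisor of `x^l - 1`, `f(1/x)` and `f*` differ by a power of `x` and a nonzero
constant, both units. -/
theorem dvd_mul_expand_iff {l : ℕ} (hl : 0 < l) {p : F[X]} (hp : p ∣ X ^ l - 1) {f : F[X]}
    (hf : f ≠ 0) (a : F[X]) : p ∣ a * expand F (l - 1) f ↔ p ∣ a * recip f := by
  have hu : IsUnit (C f.trailingCoeff) :=
    isUnit_C.2 (trailingCoeff_nonzero_iff_nonzero.2 hf).isUnit
  have h := (hp.trans (dvd_X_pow_mul_expand_sub_recip hl f)).mul_left a
  have h2 : p ∣ X ^ f.natDegree * (a * expand F (l - 1) f) ↔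
      p ∣ C f.trailingCoeff * (a * recip f) := by
    refine (dvd_iff_dvd_of_dvd_sub ?_)
    convert h using 1
    ring
  rw [hu.dvd_mul_left] at h2
  rw [← h2]
  exact ⟨fun h => h.mul_left _, (isCoprime_X_pow hl hp _).dvd_of_dvd_mul_left⟩

end Reciprocal

/-! ### The inner product as a constant coefficient modulo `x^l - 1`. -/

section CyclicCoefficient

variable {F : Type*} [Field F]

/-- The constant coefficient of the remainder modulo `x ^ m - 1`. -/
noncomputable def cyclicCoeff (F : Type*) [Field F] (m : ℕ) : F[X] →ₗ[F] F :=
  lcoeff F 0 ∘ₗ modByMonicHom (X ^ m - 1)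

theorem cyclicCoeff_eq_of_dvd_sub {m : ℕ} (hm : 0 < m) {f g : F[X]}
    (h : X ^ m - 1 ∣ f - g) : cyclicCoeff F m f = cyclicCoeff F m g := by
  rw [← sub_eq_zero, ← map_sub]
  simp [cyclicCoeff, (modByMonic_eq_zero_iff_dvd (monic_X_pow_sub_one hm)).2 h]

theorem X_pow_sub_one_dvd_sub_modByMonic {m : ℕ} (f : F[X]) :
    X ^ m - 1 ∣ f - f %ₘ (X ^ m - 1) :=
  ⟨f /ₘ (X ^ m - 1), by linear_combination - modByMonic_add_div f (X ^ m - 1)⟩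

theorem cyclicCoeff_X_pow {m : ℕ} (hm : 0 < m) (k : ℕ) :
    cyclicCoeff F m (X ^ k) = if m ∣ k then 1 else 0 := by
  have h : X ^ m - 1 ∣ (X ^ k - X ^ (k % m) : F[X]) := by
    have : (X ^ k - X ^ (k % m) : F[X]) = X ^ (k % m) * (X ^ (m * (k / m)) - 1) := by
      conv_lhs => rw [← Nat.mod_add_div k m]
      simp only [Nat.add_mul_mod_self_left, Nat.mod_mod]
      ring
    rw [this]
    exact (X_pow_sub_one_dvd (dvd_mul_right _ _)).mul_left _
  rw [cyclicCoeff_eq_of_dvd_sub hm h]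
  have hd : (X ^ (k % m) : F[X]) %ₘ (X ^ m - 1) = X ^ (k % m) := by
    rw [modByMonic_eq_self_iff (monic_X_pow_sub_one hm), degree_X_pow,
      degree_eq_natDegree (monic_X_pow_sub_one hm).ne_zero, natDegree_X_pow_sub_one]
    exact_mod_cast Nat.mod_lt k hm
  simp [cyclicCoeff, hd, coeff_X_pow, Nat.dvd_iff_mod_eq_zero, eq_comm]

theorem cyclicCoeff_C_mul (m : ℕ) (a : F) (f : F[X]) :
    cyclicCoeff F m (C a * f) = a * cyclicCoeff F m f := by
  rw [← smul_eq_C_mul, map_smul, smul_eq_mul]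

/-- A polynomial is determined modulo `x ^ l - 1` by the coefficients of its cyclic shifts. -/
theorem dvd_of_cyclicCoeff_eq_zero {l : ℕ} (hl : 0 < l) {f : F[X]}
    (h : ∀ k, cyclicCoeff F l (X ^ k * f) = 0) : X ^ l - 1 ∣ f := by
  have hmon := monic_X_pow_sub_one (F := F) hl
  rw [← modByMonic_eq_zero_iff_dvd hmon]
  set r := f %ₘ (X ^ l - 1)
  have hrd : r.natDegree < l := natDegree_modByMonic_X_pow_sub_one_lt hl f
  have hsub : X ^ l - 1 ∣ f - r := X_pow_sub_one_dvd_sub_modByMonic f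
  ext j
  rcases lt_or_ge j l with hj | hj
  · have h1 := h (l - j)
    rw [cyclicCoeff_eq_of_dvd_sub hl (g := X ^ (l - j) * r)
      (by rw [← mul_sub]; exact hsub.mul_left _), as_sum_range_C_mul_X_pow' r hrd,
      Finset.mul_sum, map_sum,
      Finset.sum_eq_single j] at h1
    · rw [mul_left_comm, cyclicCoeff_C_mul, ← pow_add, cyclicCoeff_X_pow hl,
        if_pos (by rw [Nat.sub_add_cancel hj.le]), mul_one] at h1
      simpa using h1
    · intro b hb hbj
      rw [mul_left_comm, cyclicCoeff_C_mul, ← pow_add, cyclicCoeff_X_pow hl, if_neg, mul_zero]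
      rw [Finset.mem_range] at hb
      -- The exponent lies strictly between `0` and `2l`, so it could only equal `l`, which forces
      -- `b = j`.
      rintro ⟨k, hk⟩
      rcases Nat.lt_or_ge k 1 with hk1 | hk1
      · interval_cases k
        omega
      rcases Nat.lt_or_ge k 2 with hk2 | hk2
      · interval_cases k
        omega
      · nlinarith [Nat.mul_le_mul_left l hk2, Nat.sub_le l j]
    · simp [hj]
  · rw [coeff_eq_zero_of_natDegree_lt (by omega), coeff_zero]

/-- The quotient `(x ^ l - 1) / (x ^ m - 1)`. -/
noncomputable def cyclicCofactor (F : Type*) [Field F] (m l : ℕ) : F[X] :=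
  ∑ j ∈ Finset.range (l / m), X ^ (m * j)

theorem cyclicCofactor_mul {m l : ℕ} (h : m ∣ l) :
    cyclicCofactor F m l * (X ^ m - 1) = X ^ l - 1 := by
  conv_rhs => rw [← Nat.mul_div_cancel' h, pow_mul]
  simp only [cyclicCofactor, pow_mul]
  exact geom_sum_mul _ _

/-- Among the shifts by multiples of `m` summed in the cofactor, exactly one takes a given multiple
of `m` to a multiple of `l`. This lets blocks of lengths `m` and `n` share the modulus `x^l - 1`. -/
theorem cyclicCoeff_mul_cyclicCofactor {m l : ℕ} (hm : 0 < m) (hl : 0 < l) (h : m ∣ l)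
    (f : F[X]) : cyclicCoeff F l (f * cyclicCofactor F m l) = cyclicCoeff F m f := by
  induction f using Polynomial.induction_on' with
  | add p q hp hq => rw [add_mul, map_add, map_add, hp, hq]
  | monomial k a =>
    rw [← C_mul_X_pow_eq_monomial, mul_assoc, cyclicCoeff_C_mul, cyclicCoeff_C_mul]
    congr 1
    obtain ⟨s, rfl⟩ := h
    have hs : 0 < s := Nat.pos_of_mul_pos_left hl
    rw [cyclicCofactor, Nat.mul_div_cancel_left _ hm, Finset.mul_sum, map_sum,
      cyclicCoeff_X_pow hm]
    simp only [← pow_add, cyclicCoeff_X_pow hl]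
    split_ifs with hk
    · obtain ⟨k, rfl⟩ := hk
      simp only [← mul_add, Nat.mul_dvd_mul_iff_left hm]
      -- This is the residue of `-k` modulo `s`; the outer reduction handles `s ∣ k`.
      rw [Finset.sum_eq_single ((s - k % s) % s)]
      · rw [if_pos]
        have := Nat.mod_lt k hs
        rw [Nat.dvd_iff_mod_eq_zero, Nat.add_mod, Nat.mod_mod, ← Nat.add_mod,
          ← Nat.mod_add_mod, Nat.add_sub_cancel' this.le, Nat.mod_self]
      · intro b hb hne
        rw [if_neg]
        intro hd
        apply hne
        rw [Finset.mem_range] at hb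
        have h1 := Nat.mod_lt k hs
        rw [Nat.dvd_iff_mod_eq_zero, ← Nat.mod_add_mod] at hd
        obtain ⟨c, hc⟩ := Nat.dvd_of_mod_eq_zero hd
        have hc2 : c < 2 := by
          by_contra hcon
          push Not at hcon
          nlinarith [Nat.mul_le_mul_left s hcon]
        interval_cases c
        · have h2 : k % s = 0 := by omega
          have h3 : b = 0 := by omega
          simp [h2, h3]
        · have h2 : s - k % s = b := by omega
          rw [h2, Nat.mod_eq_of_lt hb]
      · intro hn
        exact absurd (Finset.mem_range.2 (Nat.mod_lt _ hs)) hn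
    · refine Finset.sum_eq_zero fun j _ => if_neg fun hd => hk ?_
      exact (Nat.dvd_add_left (dvd_mul_right m j)).1 ((dvd_mul_right m s).trans hd)

/-- The exponent `i + (l - 1) j` is congruent to `i - j` modulo `m`, so only the diagonal terms
reach the constant coefficient. -/
theorem cyclicCoeff_sum_mul_expand_sum {m l : ℕ} (hm : 0 < m) (hl : 0 < l) (h : m ∣ l)
    (a b : Fin m → F) :
    cyclicCoeff F m ((∑ i, C (a i) * X ^ (i : ℕ)) *
      expand F (l - 1) (∑ i, C (b i) * X ^ (i : ℕ))) = ∑ i, a i * b i := by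
  rw [map_sum, Finset.sum_mul_sum, map_sum]
  refine Finset.sum_congr rfl fun i _ => ?_
  rw [map_sum, Finset.sum_eq_single i]
  all_goals simp only [map_mul, map_pow, expand_C, expand_X, ← pow_mul]
  · rw [mul_mul_mul_comm, ← C_mul, cyclicCoeff_C_mul, ← pow_add, cyclicCoeff_X_pow hm, if_pos,
      mul_one]
    have : (i : ℕ) + (l - 1) * i = l * i := by
      obtain ⟨l, rfl⟩ := Nat.exists_eq_add_of_le' hl
      simp only [Nat.add_sub_cancel]
      ring
    rw [this]
    exact h.mul_right _
  · intro j _ hji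
    rw [mul_mul_mul_comm, ← C_mul, cyclicCoeff_C_mul, ← pow_add, cyclicCoeff_X_pow hm, if_neg,
      mul_zero]
    intro hd
    apply hji
    have h1 : (m : ℤ) ∣ ((i : ℕ) : ℤ) - ((j : ℕ) : ℤ) := by
      obtain ⟨k, rfl⟩ := Nat.exists_eq_add_of_le' hl
      rw [Nat.add_sub_cancel] at hd
      have h2 := dvd_sub (Int.natCast_dvd_natCast.2 hd)
        ((Int.natCast_dvd_natCast.2 h).mul_right ((j : ℕ) : ℤ))
      push_cast at h2
      rw [show ((i : ℕ) : ℤ) - ((j : ℕ) : ℤ) = (i : ℕ) + k * (j : ℕ) - (k + 1) * (j : ℕ) by ring]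
      exact h2
    have h5 := Int.eq_zero_of_abs_lt_dvd h1 (by
      rw [abs_lt]
      have := i.2
      have := j.2
      constructor <;> omega)
    ext
    omega
  · simp

end CyclicCoefficient

end DoubleCyclic

namespace DoubleCyclic

/-! ### Double cyclic codes over `F` and the generators of their duals. -/

section FieldCodes

variable {F : Type*} [Field F]

/-- Membership of the class of `(a | b)` in the double cyclic code `⟨(ι | 0), (ℓ | θ)⟩` over the
field `F`, when `ι` divides `x ^ m - 1`. -/
def MemCode (n : ℕ) (ι ℓ θ a b : F[X]) : Prop :=
  ∃ w, ι ∣ a - w * ℓ ∧ X ^ n - 1 ∣ b - w * θ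

/-- The class of `(a | b)` is orthogonal to all cyclic shifts of `(c | d)`. -/
def CyclicOrthogonal (m n : ℕ) (a b c d : F[X]) : Prop :=
  X ^ Nat.lcm m n - 1 ∣
    a * expand F (Nat.lcm m n - 1) c * cyclicCofactor F m (Nat.lcm m n) +
      b * expand F (Nat.lcm m n - 1) d * cyclicCofactor F n (Nat.lcm m n)

theorem X_pow_sub_one_dvd_expand {m : ℕ} (k : ℕ) {a : F[X]} (ha : X ^ m - 1 ∣ a) :
    X ^ m - 1 ∣ expand F k a := by
  obtain ⟨q, rfl⟩ := ha
  rw [map_mul, map_sub, map_pow, expand_X, map_one, ← pow_mul]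
  exact (X_pow_sub_one_dvd (dvd_mul_left m _)).mul_right _

theorem X_pow_sub_one_dvd_mul_cyclicCofactor {m l : ℕ} (hml : m ∣ l) {a : F[X]}
    (ha : X ^ m - 1 ∣ a) : X ^ l - 1 ∣ a * cyclicCofactor F m l := by
  rw [← cyclicCofactor_mul hml, mul_comm]
  exact mul_dvd_mul_right ha _

theorem CyclicOrthogonal.congr_right {m n : ℕ} {a b c d c' d' : F[X]}
    (h : CyclicOrthogonal m n a b c d) (hc : X ^ m - 1 ∣ c - c') (hd : X ^ n - 1 ∣ d - d') :
    CyclicOrthogonal m n a b c' d' := by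
  have h1 := X_pow_sub_one_dvd_mul_cyclicCofactor (Nat.dvd_lcm_left m n)
    ((X_pow_sub_one_dvd_expand (Nat.lcm m n - 1) hc).mul_left a)
  have h2 := X_pow_sub_one_dvd_mul_cyclicCofactor (Nat.dvd_lcm_right m n)
    ((X_pow_sub_one_dvd_expand (Nat.lcm m n - 1) hd).mul_left b)
  unfold CyclicOrthogonal at h ⊢
  convert dvd_sub h (dvd_add h1 h2) using 1
  simp only [map_sub]
  ring

theorem CyclicOrthogonal.congr_left {m n : ℕ} {a b c d a' b' : F[X]}
    (h : CyclicOrthogonal m n a b c d) (ha : X ^ m - 1 ∣ a - a') (hb : X ^ n - 1 ∣ b - b') :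
    CyclicOrthogonal m n a' b' c d := by
  have h1 := X_pow_sub_one_dvd_mul_cyclicCofactor (Nat.dvd_lcm_left m n)
    (ha.mul_right (expand F (Nat.lcm m n - 1) c))
  have h2 := X_pow_sub_one_dvd_mul_cyclicCofactor (Nat.dvd_lcm_right m n)
    (hb.mul_right (expand F (Nat.lcm m n - 1) d))
  unfold CyclicOrthogonal at h ⊢
  convert dvd_sub h (dvd_add h1 h2) using 1
  ring

theorem cyclicCofactor_ne_zero {m l : ℕ} (hl : 0 < l) (hml : m ∣ l) :
    cyclicCofactor F m l ≠ 0 := by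
  intro h
  have := cyclicCofactor_mul (F := F) hml
  rw [h, zero_mul] at this
  exact (monic_X_pow_sub_one hl).ne_zero this.symm

/-- The dual of the code `⟨(ι | 0), (ℓ | θ)⟩` in terms of the generators. -/
theorem forall_cyclicOrthogonal_iff_generators {m n : ℕ} (hm : 0 < m) (hn : 0 < n)
    {ι ℓ θ : F[X]} (hι : ι ∣ X ^ m - 1) (a b : F[X]) :
    (∀ c d, MemCode n ι ℓ θ c d → CyclicOrthogonal m n a b c d) ↔
      X ^ m - 1 ∣ a * recip ι ∧ CyclicOrthogonal m n a b ℓ θ := by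
  have hl : 0 < Nat.lcm m n := Nat.lcm_pos hm hn
  have hι0 : ι ≠ 0 := ne_zero_of_dvd_ne_zero (monic_X_pow_sub_one hm).ne_zero hι
  have key : CyclicOrthogonal m n a b ι 0 ↔ X ^ m - 1 ∣ a * recip ι := by
    rw [CyclicOrthogonal, map_zero, mul_zero, zero_mul, add_zero,
      ← cyclicCofactor_mul (Nat.dvd_lcm_left m n), mul_comm (cyclicCofactor F m _),
      mul_dvd_mul_iff_right (cyclicCofactor_ne_zero hl (Nat.dvd_lcm_left m n)),
      dvd_mul_expand_iff hl (X_pow_sub_one_dvd (Nat.dvd_lcm_left m n)) hι0]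
  rw [← key]
  constructor
  · intro h
    exact ⟨h _ _ ⟨0, by simp⟩, h _ _ ⟨1, by simp⟩⟩
  · rintro ⟨h1, h2⟩ c d ⟨w, ⟨u, hu⟩, hw⟩
    have h3 : CyclicOrthogonal m n a b c (w * θ) := by
      have e : c = u * ι + w * ℓ := by linear_combination hu
      rw [e]
      unfold CyclicOrthogonal at h1 h2 ⊢
      convert dvd_add (h1.mul_left (expand F (Nat.lcm m n - 1) u))
        (h2.mul_left (expand F (Nat.lcm m n - 1) w)) using 1
      simp only [map_add, map_mul, map_zero]
      ring
    exact h3.congr_right (by simp) (by rw [dvd_sub_comm]; exact hw)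

/-- Multiplication by the unit `x^(deg ℓ)` turns `ℓ(1/x)` into `lc(ℓ) ℓ*` and leaves `x^(deg ℓ - deg
θ)` beside `θ*`. Adding `l` to that exponent keeps it natural and changes nothing, as `x^l ≡ 1`. -/
theorem cyclicOrthogonal_iff_recip {m n : ℕ} (hm : 0 < m) (hn : 0 < n) {ℓ θ : F[X]}
    (hθ : θ ∣ X ^ n - 1) (a b : F[X]) :
    CyclicOrthogonal m n a b ℓ θ ↔
      X ^ Nat.lcm m n - 1 ∣
        C ℓ.trailingCoeff * a * recip ℓ * cyclicCofactor F m (Nat.lcm m n) +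
          C θ.trailingCoeff * b * recip θ * X ^ (Nat.lcm m n - θ.natDegree + ℓ.natDegree) *
            cyclicCofactor F n (Nat.lcm m n) := by
  have hl : 0 < Nat.lcm m n := Nat.lcm_pos hm hn
  have hdeg : θ.natDegree ≤ Nat.lcm m n := by
    refine (natDegree_le_of_dvd hθ (monic_X_pow_sub_one hn).ne_zero).trans ?_
    rw [natDegree_X_pow_sub_one]
    exact Nat.le_of_dvd hl (Nat.dvd_lcm_right m n)
  obtain ⟨s, hs⟩ := Nat.exists_eq_add_of_le hdeg
  have h1 := dvd_X_pow_mul_expand_sub_recip hl ℓ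
  have h2 := dvd_X_pow_mul_expand_sub_recip hl θ
  unfold CyclicOrthogonal
  have hc := isCoprime_X_pow (F := F) hl dvd_rfl ℓ.natDegree
  rw [show ∀ y : F[X], X ^ Nat.lcm m n - 1 ∣ y ↔ X ^ Nat.lcm m n - 1 ∣ X ^ ℓ.natDegree * y from
    fun y => ⟨fun h => h.mul_left _, hc.dvd_of_dvd_mul_left⟩]
  refine dvd_iff_dvd_of_dvd_sub ?_
  rw [show Nat.lcm m n - θ.natDegree = s by omega]
  have h3 : (X ^ Nat.lcm m n - 1 : F[X]) ∣ X ^ s * X ^ θ.natDegree - 1 := by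
    rw [← pow_add, add_comm, ← hs]
  convert dvd_sub (dvd_add (h1.mul_left (a * cyclicCofactor F m (Nat.lcm m n)))
    (h2.mul_left (X ^ s * X ^ ℓ.natDegree * b * cyclicCofactor F n (Nat.lcm m n))))
    (h3.mul_left (X ^ ℓ.natDegree * b * expand F (Nat.lcm m n - 1) θ *
      cyclicCofactor F n (Nat.lcm m n))) using 1
  ring

/-- Coprimality passes to reciprocals. -/
theorem exists_dvd_recip_mul_sub_one {l : ℕ} (hl : 0 < l) {p q : F[X]} (hp : p ∣ X ^ l - 1)
    (h : IsCoprime p q) : ∃ u, recip p ∣ recip q * u - 1 := by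
  obtain ⟨a, b, hab⟩ := h
  have hp0 : p ≠ 0 := ne_zero_of_dvd_ne_zero (monic_X_pow_sub_one hl).ne_zero hp
  have hpr := recip_dvd_X_pow_sub_one hl hp
  have h1 : recip p ∣ expand F (l - 1) a * expand F (l - 1) p :=
    (dvd_mul_expand_iff hl hpr hp0 _).2 (dvd_mul_left _ _)
  have h2 := hpr.trans (dvd_X_pow_mul_expand_sub_recip hl q)
  have h3 : recip p ∣ X ^ ((l - 1) * q.natDegree) * X ^ q.natDegree - 1 := by
    rw [← pow_add, ← Nat.succ_mul, Nat.succ_eq_add_one, Nat.sub_add_cancel hl]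
    exact hpr.trans (X_pow_sub_one_dvd (dvd_mul_right _ _))
  have h4 := congrArg (expand F (l - 1)) hab
  rw [map_add, map_mul, map_mul, map_one] at h4
  -- Substituting `1/x` in the Bézout identity makes `b(1/x)` inverse to `q(1/x)`, which is `lc(q)
  -- x^(-deg q) q*`; the power `x^((l - 1) deg q)` stands for `x^(-deg q)`.
  refine ⟨C q.trailingCoeff * X ^ ((l - 1) * q.natDegree) * expand F (l - 1) b, ?_⟩
  convert dvd_sub (dvd_sub (h3.mul_left (expand F (l - 1) b * expand F (l - 1) q)) h1)
    (h2.mul_left (X ^ ((l - 1) * q.natDegree) * expand F (l - 1) b)) using 1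
  linear_combination h4

/-- The factorizations behind the parity-check polynomials of `⟨(ι | 0), (ℓ | θ)⟩`. -/
theorem exists_recip_factorization {m n : ℕ} (hm : 0 < m) {ι ℓ θ : F[X]}
    (hι : ι ∣ X ^ m - 1) (hθ : θ ∣ X ^ n - 1)
    (hker : ∀ w, X ^ n - 1 ∣ w * θ → ι ∣ w * ℓ) (hn : 0 < n) :
    ∃ κ ι₁ ℓ₁ τ : F[X], X ^ m - 1 = recip ι * κ ∧ recip ι = gcdRecip ι ℓ * ι₁ ∧
      recip ℓ = gcdRecip ι ℓ * ℓ₁ ∧ X ^ n - 1 = recip θ * (ι₁ * τ) ∧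
      (∃ u, ι₁ ∣ ℓ₁ * u - 1) ∧ (ι ∣ ℓ → ι₁ = 1) := by
  classical
  have hι0 : ι ≠ 0 := ne_zero_of_dvd_ne_zero (monic_X_pow_sub_one hm).ne_zero hι
  unfold gcdRecip
  set g := EuclideanDomain.gcd ι ℓ with hg
  obtain ⟨p, hp⟩ : g ∣ ι := EuclideanDomain.gcd_dvd_left _ _
  obtain ⟨q, hq⟩ : g ∣ ℓ := EuclideanDomain.gcd_dvd_right _ _
  have hg0 : g ≠ 0 := by
    intro h
    rw [h, zero_mul] at hp
    exact hι0 hp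
  have hcop : IsCoprime p q := by
    refine ⟨EuclideanDomain.gcdA ι ℓ, EuclideanDomain.gcdB ι ℓ, mul_left_cancel₀ hg0 ?_⟩
    have := EuclideanDomain.gcd_eq_gcd_ab ι ℓ
    rw [← hg] at this
    linear_combination (-1 : F[X]) * this - EuclideanDomain.gcdA ι ℓ * hp
      - EuclideanDomain.gcdB ι ℓ * hq
  obtain ⟨t, ht⟩ := hθ
  have hpt : p ∣ t := by
    -- Here the kernel condition enters: `t` annihilates `θ` modulo `x^n - 1`, so `ι ∣ tℓ`, and
    -- cancelling `g` leaves `p ∣ tq`.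
    have h1 := hker t ⟨1, by rw [mul_comm t, ← ht, mul_one]⟩
    rw [hp, hq, mul_left_comm, mul_dvd_mul_iff_left hg0] at h1
    exact hcop.dvd_of_dvd_mul_right h1
  obtain ⟨τ, hτ⟩ := hpt
  obtain ⟨κ, hκ⟩ := recip_dvd_X_pow_sub_one hm hι
  refine ⟨κ, recip p, recip q, recip τ, hκ, ?_, ?_, ?_, ?_, ?_⟩
  · rw [← recip_mul, ← hp]
  · rw [← recip_mul, ← hq]
  · rw [← recip_mul, ← hτ, ← recip_mul, ← ht, recip_X_pow_sub_one hn]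
  · exact exists_dvd_recip_mul_sub_one hm ((Dvd.intro_left g hp.symm).trans hι) hcop
  · intro h
    have h1 : p ∣ q := by
      rw [hp, hq] at h
      exact (mul_dvd_mul_iff_left hg0).1 h
    have h2 : IsUnit p := hcop.isUnit_of_dvd' dvd_rfl h1
    obtain ⟨c, hc, rfl⟩ := isUnit_iff.1 h2
    rw [recip, trailingCoeff, natTrailingDegree_C, coeff_C_zero, reverse_C, ← C_mul, inv_mul_cancel₀ hc.ne_zero, C_1]

/-- An explicit description of the dual of `⟨(ι | 0), (ℓ | θ)⟩`. -/
theorem forall_cyclicOrthogonal_iff {m n : ℕ} (hm : 0 < m) (hn : 0 < n)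
    {ι ℓ θ : F[X]} (hι : ι ∣ X ^ m - 1) (hθ : θ ∣ X ^ n - 1) {κ ι₁ ℓ₁ τ g : F[X]}
    (hκ : X ^ m - 1 = recip ι * κ) (hι₁ : recip ι = g * ι₁) (hℓ₁ : recip ℓ = g * ℓ₁)
    (hτ : X ^ n - 1 = recip θ * (ι₁ * τ)) (a b : F[X]) :
    (∀ c d, MemCode n ι ℓ θ c d → CyclicOrthogonal m n a b c d) ↔
      ∃ e f, a = κ * e ∧ b = τ * f ∧
        ι₁ ∣ C ℓ.trailingCoeff * e * ℓ₁ +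
          C θ.trailingCoeff * f * X ^ (Nat.lcm m n - θ.natDegree + ℓ.natDegree) := by
  have hl : 0 < Nat.lcm m n := Nat.lcm_pos hm hn
  have hι0 : ι ≠ 0 := ne_zero_of_dvd_ne_zero (monic_X_pow_sub_one hm).ne_zero hι
  have hθ0 : θ ≠ 0 := ne_zero_of_dvd_ne_zero (monic_X_pow_sub_one hn).ne_zero hθ
  have hru : IsUnit (C θ.trailingCoeff) :=
    isUnit_C.2 (trailingCoeff_nonzero_iff_nonzero.2 hθ0).isUnit
  rw [forall_cyclicOrthogonal_iff_generators hm hn hι, cyclicOrthogonal_iff_recip hm hn hθ]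
  generalize Nat.lcm m n - θ.natDegree + ℓ.natDegree = T
  have hEm := cyclicCofactor_mul (F := F) (Nat.dvd_lcm_left m n)
  have hEn := cyclicCofactor_mul (F := F) (Nat.dvd_lcm_right m n)
  set Em := cyclicCofactor F m (Nat.lcm m n)
  set En := cyclicCofactor F n (Nat.lcm m n)
  have hXl : (X ^ Nat.lcm m n - 1 : F[X]) ≠ 0 := (monic_X_pow_sub_one hl).ne_zero
  have hι₁0 : ι₁ ≠ 0 := by
    rintro rfl
    rw [mul_zero] at hι₁
    exact (monic_recip hι0).ne_zero hι₁
  -- Both sides are `(x^l - 1)/ι₁`, the factor to be cancelled from the orthogonality relation.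
  have hZ : κ * g * Em = τ * recip θ * En := by
    refine mul_left_cancel₀ hι₁0 ?_
    linear_combination hEm - Em * hκ - Em * κ * hι₁ - hEn + En * hτ
  have hZl : (X ^ Nat.lcm m n - 1 : F[X]) = κ * g * Em * ι₁ := by
    linear_combination - hEm + Em * hκ + Em * κ * hι₁
  have hZ0 : κ * g * Em ≠ 0 := left_ne_zero_of_mul (hZl ▸ hXl)
  have hA : X ^ m - 1 ∣ a * recip ι ↔ κ ∣ a := by
    rw [hκ, mul_comm a, mul_dvd_mul_iff_left (monic_recip hι0).ne_zero]
  have hB : ∀ e f, (X ^ Nat.lcm m n - 1 ∣ C ℓ.trailingCoeff * (κ * e) * recip ℓ * Em +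
      C θ.trailingCoeff * (τ * f) * recip θ * X ^ T * En) ↔
      ι₁ ∣ C ℓ.trailingCoeff * e * ℓ₁ + C θ.trailingCoeff * f * X ^ T := by
    intro e f
    rw [hZl, ← mul_dvd_mul_iff_left hZ0 (b := ι₁)]
    refine iff_of_eq (congrArg _ ?_)
    linear_combination C ℓ.trailingCoeff * κ * e * Em * hℓ₁
      - C θ.trailingCoeff * f * X ^ T * hZ
  rw [hA]
  constructor
  · rintro ⟨⟨e, rfl⟩, h⟩
    -- The common factor divides the first summand, hence the second; cancelling `θ* En` leaves `τ ∣
    -- x^T b` up to a constant, and `x` is a unit modulo `τ`.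
    have hdvd : τ ∣ b := by
      have h1 : κ * g * Em ∣ C θ.trailingCoeff * b * recip θ * X ^ T * En := by
        have h2 := (Dvd.intro ι₁ hZl.symm).trans h
        rw [hℓ₁] at h2
        refine (dvd_add_right ?_).1 h2
        exact ⟨C ℓ.trailingCoeff * e * ℓ₁, by ring⟩
      have hRE : recip θ * En ≠ 0 := by
        rw [hZ, mul_assoc] at hZ0
        exact right_ne_zero_of_mul hZ0
      rw [hZ, show C θ.trailingCoeff * b * recip θ * X ^ T * En =
        (C θ.trailingCoeff * (X ^ T * b)) * (recip θ * En) by ring, mul_assoc,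
        mul_dvd_mul_iff_right hRE, hru.dvd_mul_left] at h1
      refine (isCoprime_X_pow hn ?_ T).dvd_of_dvd_mul_left h1
      exact ⟨recip θ * ι₁, by rw [hτ]; ring⟩
    obtain ⟨f, rfl⟩ := hdvd
    exact ⟨e, f, rfl, rfl, (hB e f).1 h⟩
  · rintro ⟨e, f, rfl, rfl, h⟩
    exact ⟨dvd_mul_right _ _, (hB e f).2 h⟩

theorem div_eq_of_eq_mul {p q r : F[X]} (hq : q ≠ 0) (h : p = q * r) : p / q = r := by
  rw [h, mul_div_cancel_left₀ _ hq]

/-- The generators of the dual of a double cyclic code over a field. -/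
theorem dual_generators {m n : ℕ} (hm : 0 < m) (hn : 0 < n)
    {ι ℓ θ : F[X]} (hι : ι ∣ X ^ m - 1) (hθ : θ ∣ X ^ n - 1)
    (hker : ∀ w, X ^ n - 1 ∣ w * θ → ι ∣ w * ℓ)
    {ι' ℓ' θ' : F[X]} (hθ' : θ' ∣ X ^ n - 1)
    (hker' : ∀ w, X ^ n - 1 ∣ w * θ' → ι' ∣ w * ℓ')
    (hι'm : ι'.Monic) (hθ'm : θ'.Monic) (hdeg : ℓ'.degree < ι'.degree)
    (hdual : ∀ a b, MemCode n ι' ℓ' θ' a b ↔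
      ∀ c d, MemCode n ι ℓ θ c d → CyclicOrthogonal m n a b c d) :
    (gcdRecip ι ℓ ∣ X ^ m - 1 ∧ ι' = (X ^ m - 1) / gcdRecip ι ℓ) ∧
    (recip ι * recip θ ∣ (X ^ n - 1) * gcdRecip ι ℓ ∧
      θ' = ((X ^ n - 1) * gcdRecip ι ℓ) / (recip ι * recip θ)) ∧
    (recip ι ∣ X ^ m - 1 ∧ ∃ ρ : F[X],
      ℓ' = ρ * ((X ^ m - 1) / recip ι) ∧ (ι ∣ ℓ → ρ = 0) ∧
      gcdRecip ι ℓ ∣ recip ι ∧ gcdRecip ι ℓ ∣ recip ℓ ∧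
      (∃ u : F[X], recip ι / gcdRecip ι ℓ ∣ recip ℓ / gcdRecip ι ℓ * u - 1) ∧
      ∀ u : F[X], recip ι / gcdRecip ι ℓ ∣ recip ℓ / gcdRecip ι ℓ * u - 1 →
        ρ = (-C (θ.trailingCoeff / ℓ.trailingCoeff) *
            X ^ (Nat.lcm m n - θ.natDegree + ℓ.natDegree) * u) %
          (recip ι / gcdRecip ι ℓ)) := by
  obtain ⟨κ, ι₁, ℓ₁, τ, hκ, hι₁, hℓ₁, hτ, hu, hsep⟩ :=
    exists_recip_factorization hm hι hθ hker hn
  have hι0 : ι ≠ 0 := ne_zero_of_dvd_ne_zero (monic_X_pow_sub_one hm).ne_zero hι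
  have hθ0 : θ ≠ 0 := ne_zero_of_dvd_ne_zero (monic_X_pow_sub_one hn).ne_zero hθ
  simp_rw [forall_cyclicOrthogonal_iff hm hn hι hθ hκ hι₁ hℓ₁ hτ] at hdual
  have hιm := monic_recip hι0
  have hθm := monic_recip hθ0
  have hg0 : gcdRecip ι ℓ ≠ 0 := by
    intro h
    rw [h, zero_mul] at hι₁
    exact hιm.ne_zero hι₁
  have hgm : (gcdRecip ι ℓ).Monic := by
    unfold gcdRecip at hg0 ⊢
    refine monic_recip fun h => hg0 ?_
    rw [h]
    simp [recip]
  have hι₁m : ι₁.Monic := hgm.of_mul_monic_left (hι₁ ▸ hιm)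
  have hκm : κ.Monic := hιm.of_mul_monic_left (hκ ▸ monic_X_pow_sub_one hm)
  have hτm : τ.Monic :=
    hι₁m.of_mul_monic_left (hθm.of_mul_monic_left (hτ ▸ monic_X_pow_sub_one hn))
  generalize Nat.lcm m n - θ.natDegree + ℓ.natDegree = T at *
  obtain ⟨u₀, hu₀⟩ := hu
  have hℓunit : ℓ ≠ 0 → IsUnit (C ℓ.trailingCoeff) := fun h =>
    isUnit_C.2 (trailingCoeff_nonzero_iff_nonzero.2 h).isUnit
  have hι₁one : ℓ = 0 → ι₁ = 1 := fun h => hsep (h ▸ dvd_zero _)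
  -- solutions of the congruence
  have hsolve : ∀ e f u, ι₁ ∣ ℓ₁ * u - 1 →
      (ι₁ ∣ C ℓ.trailingCoeff * e * ℓ₁ + C θ.trailingCoeff * f * X ^ T ↔
      ι₁ ∣ e - f * (-C (θ.trailingCoeff / ℓ.trailingCoeff) * X ^ T * u)) := by
    intro e f u hu
    -- For `ℓ = 0` the quotient by `lc(ℓ)` is a junk value, harmless because the modulus `ι₁` is
    -- `1`.
    rcases eq_or_ne ℓ 0 with h0 | h0
    · simp [hι₁one h0]
    have hc : C ℓ.trailingCoeff * C (θ.trailingCoeff / ℓ.trailingCoeff) = C θ.trailingCoeff := by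
      rw [← C_mul, mul_div_cancel₀ _ (trailingCoeff_nonzero_iff_nonzero.2 h0)]
    have hcop : IsCoprime ι₁ ℓ₁ := by
      obtain ⟨k, hk⟩ := hu
      exact ⟨-k, u, by linear_combination hk⟩
    have h1 : ι₁ ∣ e - f * (-C (θ.trailingCoeff / ℓ.trailingCoeff) * X ^ T * u) ↔
        ι₁ ∣ C ℓ.trailingCoeff *
          (ℓ₁ * (e - f * (-C (θ.trailingCoeff / ℓ.trailingCoeff) * X ^ T * u))) := by
      rw [(hℓunit h0).dvd_mul_left]
      exact ⟨fun h => h.mul_left _, hcop.dvd_of_dvd_mul_left⟩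
    rw [h1]
    refine dvd_iff_dvd_of_dvd_sub ?_
    have := hu.mul_left (- (C θ.trailingCoeff * f * X ^ T))
    convert this using 1
    linear_combination (-ℓ₁ * f * X ^ T * u) * hc
  have e1 : recip ι / gcdRecip ι ℓ = ι₁ := div_eq_of_eq_mul hg0 hι₁
  have e2 : recip ℓ / gcdRecip ι ℓ = ℓ₁ := div_eq_of_eq_mul hg0 hℓ₁
  have e3 : (X ^ m - 1) / recip ι = κ := div_eq_of_eq_mul hιm.ne_zero hκ
  have e4 : (X ^ m - 1 : F[X]) = gcdRecip ι ℓ * (κ * ι₁) := by rw [hκ, hι₁]; ring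
  have e5 : (X ^ n - 1) * gcdRecip ι ℓ = (recip ι * recip θ) * τ := by rw [hτ, hι₁]; ring
  -- first block
  have hι' : ι' = κ * ι₁ := by
    refine eq_of_monic_of_associated hι'm (hκm.mul hι₁m)
      (associated_of_dvd_dvd ?_ ?_)
    -- The pair `e = ι₁`, `f = 0` solves the congruence; the kernel condition of the dual then
    -- yields `ι' ∣ κ ι₁`.
    · obtain ⟨w, hw1, hw2⟩ := (hdual (κ * ι₁) 0).2 ⟨ι₁, 0, rfl, by simp, by
        rw [mul_zero, zero_mul, add_zero]; exact ⟨C ℓ.trailingCoeff * ℓ₁, by ring⟩⟩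
      have := hker' w (by simpa using hw2)
      exact (dvd_sub_left this).1 hw1
    · obtain ⟨e, f, he, hf, h⟩ := (hdual ι' 0).1 ⟨0, by simp⟩
      have hf0 : f = 0 := (mul_eq_zero.1 hf.symm).resolve_left hτm.ne_zero
      rw [hsolve e f u₀ hu₀, hf0, zero_mul, sub_zero] at h
      rw [he]
      exact mul_dvd_mul_left _ h
  -- second block
  have hθ'' : θ' = τ := by
    refine eq_of_monic_of_associated hθ'm hτm (associated_of_dvd_dvd ?_ ?_)
    · obtain ⟨w, -, hw⟩ :=
        (hdual (κ * (-C (θ.trailingCoeff / ℓ.trailingCoeff) * X ^ T * u₀)) τ).2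
          ⟨_, 1, rfl, by simp, (hsolve _ _ u₀ hu₀).2 (by simp)⟩
      exact (dvd_sub_left (dvd_mul_left θ' w)).1 (hθ'.trans hw)
    · obtain ⟨e, f, -, hf, -⟩ := (hdual ℓ' θ').1 ⟨1, by simp⟩
      exact ⟨f, hf⟩
  obtain ⟨ρ, f, hρ, hf, h⟩ := (hdual ℓ' θ').1 ⟨1, by simp⟩
  have hf1 : f = 1 := by
    refine mul_left_cancel₀ hτm.ne_zero ?_
    rw [← hf, hθ'', mul_one]
  subst hf1
  -- Cancelling `κ` from the normalization makes `ρ` its own remainder modulo `ι₁`.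
  have hρdeg : ρ.degree < ι₁.degree := by
    rw [hρ, hι', degree_mul, degree_mul] at hdeg
    exact lt_of_add_lt_add_left hdeg
  refine ⟨⟨⟨_, e4⟩, ?_⟩, ⟨⟨_, e5⟩, ?_⟩, ⟨_, hκ⟩, ρ, ?_, ?_, ⟨_, hι₁⟩, ⟨_, hℓ₁⟩, ?_, ?_⟩
  · rw [div_eq_of_eq_mul hg0 e4, hι']
  · rw [div_eq_of_eq_mul (mul_ne_zero hιm.ne_zero hθm.ne_zero) e5, hθ'']
  · rw [e3, hρ, mul_comm]
  · intro hd
    rw [hsep hd, degree_one] at hρdeg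
    exact degree_eq_bot.1 (Nat.WithBot.lt_zero_iff.1 hρdeg)
  · rw [e1, e2]
    exact ⟨u₀, hu₀⟩
  · intro u hu
    rw [e1, e2] at hu
    rw [e1]
    have h1 := (hsolve ρ 1 u hu).1 h
    rw [one_mul] at h1
    rw [← (mod_eq_self_iff hι₁m.ne_zero).2 hρdeg]
    have h2 := (EuclideanDomain.mod_eq_zero).2 h1
    rw [sub_mod] at h2
    exact sub_eq_zero.1 h2

end FieldCodes

end DoubleCyclic

namespace DoubleCyclic

/-! ### The splitting of `R` into three copies of `F`. -/

section Components

variable {F : Type*} [Field F]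

/-- The values of `v` under the three homomorphisms `R → F`. -/
def root (F : Type*) [Field F] : Fin 3 → F := ![0, 1, -1]

/-- The homomorphism `R → F` reading off the coefficient of the idempotent `vᵢ`. -/
noncomputable def component (F : Type*) [Field F] (i : Fin 3) : CoeffRing F →+* F :=
  AdjoinRoot.lift (RingHom.id F) (root F i) (by
    fin_cases i <;> simp [root]
    ring)

@[simp]
theorem component_of (i : Fin 3) (a : F) :
    component F i (AdjoinRoot.of (X ^ 3 - X) a) = a := by
  rw [component, AdjoinRoot.lift_of, RingHom.id_apply]

theorem component_algebraMap (i : Fin 3) (a : F) :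
    component F i (algebraMap F (CoeffRing F) a) = a := by
  rw [AdjoinRoot.algebraMap_eq, component_of]

theorem component_v (i : Fin 3) : component F i (v F) = root F i := by
  rw [v, component, AdjoinRoot.lift_root]

theorem v_pow_three : v F ^ 3 = v F := by
  have h := AdjoinRoot.eval₂_root (X ^ 3 - X : F[X])
  rw [eval₂_sub, eval₂_pow, eval₂_X] at h
  exact sub_eq_zero.1 h

/-- The idempotents are the Lagrange basis polynomials for the nodes `0, 1, -1`, evaluated at `v`.
-/
theorem component_idem (h2 : (2 : F) ≠ 0) (i j : Fin 3) :
    component F i (idem F j) = if i = j then 1 else 0 := by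
  have h1 : (1 + 1 : F) = 2 := one_add_one_eq_two
  fin_cases i <;> fin_cases j <;>
    simp [idem, Algebra.smul_def, component_v, root, h1, h2]

theorem v_mul_idem (j : Fin 3) :
    v F * idem F j = algebraMap F (CoeffRing F) (root F j) * idem F j := by
  have h3 := v_pow_three (F := F)
  match j with
  | 0 =>
    change v F * (1 - v F ^ 2) = algebraMap F (CoeffRing F) 0 * (1 - v F ^ 2)
    rw [map_zero]
    linear_combination -h3
  | 1 =>
    change v F * ((2⁻¹ : F) • (v F + v F ^ 2)) =
      algebraMap F (CoeffRing F) 1 * ((2⁻¹ : F) • (v F + v F ^ 2))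
    rw [map_one, Algebra.smul_def]
    linear_combination algebraMap F (CoeffRing F) 2⁻¹ * h3
  | 2 =>
    change v F * ((2⁻¹ : F) • (v F ^ 2 - v F)) =
      algebraMap F (CoeffRing F) (-1) * ((2⁻¹ : F) • (v F ^ 2 - v F))
    rw [map_neg, map_one, Algebra.smul_def]
    linear_combination algebraMap F (CoeffRing F) 2⁻¹ * h3

theorem sum_idem (h2 : (2 : F) ≠ 0) : ∑ j, idem F j = 1 := by
  have h : algebraMap F (CoeffRing F) 2⁻¹ * 2 = 1 := by
    rw [← map_ofNat (algebraMap F (CoeffRing F)) 2, ← map_mul, inv_mul_cancel₀ h2, map_one]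
  simp only [Fin.sum_univ_three, idem, Algebra.smul_def, Matrix.cons_val]
  linear_combination v F ^ 2 * h

theorem mul_idem (r : CoeffRing F) (j : Fin 3) :
    r * idem F j = algebraMap F (CoeffRing F) (component F j r) * idem F j := by
  induction r using AdjoinRoot.induction_on with
  | ih p =>
    induction p using Polynomial.induction_on with
    | C a =>
      rw [AdjoinRoot.mk_C, ← AdjoinRoot.algebraMap_eq, component_algebraMap]
    | add p q hp hq => rw [map_add, add_mul, hp, hq, map_add, map_add, add_mul]
    | monomial k a h =>
      rw [pow_succ (X : F[X]) k, ← mul_assoc, map_mul _ _ X, AdjoinRoot.mk_X, mul_assoc]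
      change _ * (v F * _) = algebraMap F (CoeffRing F) (component F j (_ * v F)) * _
      rw [v_mul_idem, mul_left_comm, h, map_mul (component F j) _ (v F), component_v,
        map_mul (algebraMap F (CoeffRing F))]
      ring

theorem component_ext (h2 : (2 : F) ≠ 0) {r s : CoeffRing F}
    (h : ∀ i, component F i r = component F i s) : r = s := by
  rw [← mul_one r, ← mul_one s, ← sum_idem h2, Finset.mul_sum, Finset.mul_sum]
  exact Finset.sum_congr rfl fun i _ => by rw [mul_idem, mul_idem s, h]

theorem map_component_ext (h2 : (2 : F) ≠ 0) {f g : (CoeffRing F)[X]}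
    (h : ∀ i, f.map (component F i) = g.map (component F i)) : f = g := by
  ext k
  refine component_ext h2 fun i => ?_
  rw [← coeff_map, ← coeff_map, h]

theorem component_sum_algebraMap_mul_idem (h2 : (2 : F) ≠ 0) (a : Fin 3 → F) (i : Fin 3) :
    component F i (∑ j, algebraMap F (CoeffRing F) (a j) * idem F j) = a i := by
  simp [component_idem h2]

@[simp]
theorem map_ofComponents (h2 : (2 : F) ≠ 0) (f : Fin 3 → F[X]) (i : Fin 3) :
    (ofComponents f).map (component F i) = f i := by
  have : (component F i).comp (AdjoinRoot.of (X ^ 3 - X)) = RingHom.id F :=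
    RingHom.ext (component_of i)
  simp [ofComponents, Polynomial.map_sum, map_map, component_idem h2, this]

theorem X_pow_sub_one_dvd_iff_component (h2 : (2 : F) ≠ 0) (m : ℕ) (f : (CoeffRing F)[X]) :
    X ^ m - 1 ∣ f ↔ ∀ i, X ^ m - 1 ∣ f.map (component F i) := by
  constructor
  · rintro ⟨k, rfl⟩ i
    exact ⟨k.map (component F i), by simp⟩
  · intro h
    choose q hq using h
    refine ⟨ofComponents q, map_component_ext h2 fun i => ?_⟩
    rw [hq i]
    simp [h2]

theorem toCyclic_eq_iff (h2 : (2 : F) ≠ 0) {m : ℕ} {f g : (CoeffRing F)[X]} :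
    toCyclic m f = toCyclic m g ↔
      ∀ i, X ^ m - 1 ∣ f.map (component F i) - g.map (component F i) := by
  rw [Ideal.Quotient.eq, Ideal.mem_span_singleton, X_pow_sub_one_dvd_iff_component h2]
  simp

end Components

/-! ### Words as triples of pairs of polynomials over `F`. -/

section Words

variable {F : Type*} [Field F]

/-- The polynomial over `F` of the `i`-th component of a block. -/
noncomputable def blockPoly {m : ℕ} (i : Fin 3) (a : Fin m → CoeffRing F) : F[X] :=
  ∑ k : Fin m, C (component F i (a k)) * X ^ (k : ℕ)

theorem map_component_block {m : ℕ} (i : Fin 3) (a : Fin m → CoeffRing F) :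
    (∑ k : Fin m, C (a k) * X ^ (k : ℕ)).map (component F i) = blockPoly i a := by
  simp [blockPoly, Polynomial.map_sum]

theorem coeff_blockPoly {m : ℕ} (i : Fin 3) (a : Fin m → CoeffRing F) (k : Fin m) :
    (blockPoly i a).coeff k = component F i (a k) := by
  simp [blockPoly, coeff_X_pow, Fin.val_inj]

theorem degree_blockPoly_lt {m : ℕ} (i : Fin 3) (a : Fin m → CoeffRing F) :
    (blockPoly i a).degree < m := by
  exact degree_sum_fin_lt _

theorem blockPoly_injective (h2 : (2 : F) ≠ 0) {m : ℕ} (hm : 0 < m)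
    {a b : Fin m → CoeffRing F} (h : ∀ i, X ^ m - 1 ∣ blockPoly i a - blockPoly i b) :
    a = b := by
  have h1 : ∀ i, blockPoly i a = blockPoly i b := by
    intro i
    refine sub_eq_zero.1 (eq_zero_of_dvd_of_degree_lt (h i) ?_)
    rw [degree_eq_natDegree (monic_X_pow_sub_one hm).ne_zero, natDegree_X_pow_sub_one]
    exact (degree_sub_le _ _).trans_lt (max_lt (degree_blockPoly_lt i a) (degree_blockPoly_lt i b))
  funext k
  refine component_ext h2 fun i => ?_
  rw [← coeff_blockPoly, ← coeff_blockPoly, h1]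

theorem exists_block (h2 : (2 : F) ≠ 0) {m : ℕ} (hm : 0 < m) (f : Fin 3 → F[X]) :
    ∃ a : Fin m → CoeffRing F, ∀ i, X ^ m - 1 ∣ f i - blockPoly i a := by
  refine ⟨fun k => ∑ j, algebraMap F (CoeffRing F) ((f j %ₘ (X ^ m - 1)).coeff k) * idem F j,
    fun i => ?_⟩
  convert X_pow_sub_one_dvd_sub_modByMonic (m := m) (f i) using 2
  simp only [blockPoly, component_sum_algebraMap_mul_idem h2]
  rw [Fin.sum_univ_eq_sum_range fun k => C ((f i %ₘ (X ^ m - 1)).coeff k) * X ^ k]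
  exact (as_sum_range_C_mul_X_pow' _ (natDegree_modByMonic_X_pow_sub_one_lt hm _)).symm

theorem wordToPoly_injective (h2 : (2 : F) ≠ 0) {m n : ℕ} (hm : 0 < m) (hn : 0 < n) :
    Function.Injective (wordToPoly : Word F m n → _) := by
  intro c d h
  rw [wordToPoly, wordToPoly, Prod.mk.injEq, toCyclic_eq_iff h2, toCyclic_eq_iff h2] at h
  simp only [map_component_block] at h
  exact Prod.ext (blockPoly_injective h2 hm h.1) (blockPoly_injective h2 hn h.2)

theorem component_innerProd {m n : ℕ} (hm : 0 < m) (hn : 0 < n) (i : Fin 3) (c d : Word F m n) :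
    component F i (innerProd c d) = cyclicCoeff F (Nat.lcm m n)
      (blockPoly i c.1 * expand F (Nat.lcm m n - 1) (blockPoly i d.1) *
          cyclicCofactor F m (Nat.lcm m n) +
        blockPoly i c.2 * expand F (Nat.lcm m n - 1) (blockPoly i d.2) *
          cyclicCofactor F n (Nat.lcm m n)) := by
  have hl : 0 < Nat.lcm m n := Nat.lcm_pos hm hn
  rw [map_add, cyclicCoeff_mul_cyclicCofactor hm hl (Nat.dvd_lcm_left m n),
    cyclicCoeff_mul_cyclicCofactor hn hl (Nat.dvd_lcm_right m n)]
  unfold blockPoly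
  rw [cyclicCoeff_sum_mul_expand_sum hm hl (Nat.dvd_lcm_left m n),
    cyclicCoeff_sum_mul_expand_sum hn hl (Nat.dvd_lcm_right m n)]
  simp [innerProd]

end Words

/-! ### Passing from codes over `R` to their components. -/

section Codes

variable {F : Type*} [Field F] {m n : ℕ} {K : Submodule (CoeffRing F) (Word F m n)}
  {ι ℓ θ : Fin 3 → F[X]}

theorem MemCode.congr {n : ℕ} {ι ℓ θ a b a' b' : F[X]} (h : MemCode n ι ℓ θ a b)
    (ha : ι ∣ a - a') (hb : X ^ n - 1 ∣ b - b') : MemCode n ι ℓ θ a' b' := by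
  obtain ⟨w, h1, h2⟩ := h
  refine ⟨w, ?_, ?_⟩
  · convert dvd_sub h1 ha using 1
    ring
  · convert dvd_sub h2 hb using 1
    ring

theorem MemCode.mul_left {n : ℕ} {ι ℓ θ a b : F[X]} (h : MemCode n ι ℓ θ a b) (p : F[X]) :
    MemCode n ι ℓ θ (p * a) (p * b) := by
  obtain ⟨w, h1, h2⟩ := h
  refine ⟨p * w, ?_, ?_⟩
  · convert h1.mul_left p using 1
    ring
  · convert h2.mul_left p using 1
    ring

theorem memCode_zero (n : ℕ) (ι ℓ θ : F[X]) : MemCode n ι ℓ θ 0 0 := ⟨0, by simp⟩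

/-- Multipliers over `R[x]` are arbitrary triples over `F[x]`, and reduction modulo `x^m - 1` is
absorbed by multiples of `ι`. -/
theorem mem_span_generators_iff (h2 : (2 : F) ≠ 0) (hι : ∀ i, ι i ∣ X ^ m - 1)
    (A B : (CoeffRing F)[X]) :
    (toCyclic m A, toCyclic n B) ∈ Submodule.span (CoeffRing F)[X]
      {(toCyclic m (ofComponents ι), (0 : CyclicRing F n)),
        (toCyclic m (ofComponents ℓ), toCyclic n (ofComponents θ))} ↔
      ∀ i, MemCode n (ι i) (ℓ i) (θ i) (A.map (component F i)) (B.map (component F i)) := by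
  rw [Submodule.mem_span_pair]
  have h : ∀ U W : (CoeffRing F)[X],
      (U • (toCyclic m (ofComponents ι), (0 : CyclicRing F n)) +
        W • (toCyclic m (ofComponents ℓ), toCyclic n (ofComponents θ)) =
          (toCyclic m A, toCyclic n B)) ↔
      (toCyclic m A = toCyclic m (U * ofComponents ι + W * ofComponents ℓ) ∧
        toCyclic n B = toCyclic n (W * ofComponents θ)) := by
    intro U W
    rw [Prod.smul_mk, Prod.smul_mk, Prod.mk_add_mk, smul_zero, zero_add, Prod.mk.injEq]
    exact and_congr eq_comm eq_comm
  simp only [h, toCyclic_eq_iff h2, Polynomial.map_add, Polynomial.map_mul, map_ofComponents h2]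
  constructor
  · rintro ⟨U, W, hU, hW⟩ i
    refine ⟨W.map (component F i), ?_, hW i⟩
    have h3 := (hι i).trans (hU i)
    rw [show ∀ a b c : F[X], a - (b + c) = (a - c) - b by intros; ring] at h3
    exact (dvd_sub_left (dvd_mul_left _ _)).1 h3
  · intro h3
    choose w hw1 hw2 using h3
    choose u hu using hw1
    refine ⟨ofComponents u, ofComponents w, fun i => ?_, fun i => ?_⟩
    · rw [map_ofComponents h2, map_ofComponents h2]
      convert dvd_zero _
      linear_combination hu i
    · rw [map_ofComponents h2]
      exact hw2 i

theorem IsGeneratedBy.mem_iff (h2 : (2 : F) ≠ 0) (hm : 0 < m) (hn : 0 < n)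
    (h : IsGeneratedBy K ι ℓ θ) (c : Word F m n) :
    c ∈ K ↔ ∀ i, MemCode n (ι i) (ℓ i) (θ i) (blockPoly i c.1) (blockPoly i c.2) := by
  have h1 : c ∈ K ↔ wordToPoly c ∈ wordToPoly '' (K : Set (Word F m n)) :=
    ((wordToPoly_injective h2 hm hn).mem_set_image).symm
  rw [h1, h.code_eq, SetLike.mem_coe, wordToPoly, mem_span_generators_iff h2 h.iota_dvd]
  simp only [map_component_block]

/-- The multiple of `(ℓ | θ)` by `w` in component `i` alone has zero second block, so its first
block lies in the ideal generated by `ι`. -/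
theorem IsGeneratedBy.iota_dvd_of_dvd (h2 : (2 : F) ≠ 0) (h : IsGeneratedBy K ι ℓ θ) (i : Fin 3)
    (w : F[X]) (hw : X ^ n - 1 ∣ w * θ i) : ι i ∣ w * ℓ i := by
  have h1 : (toCyclic m (ofComponents (Pi.single i (w * ℓ i))), (0 : CyclicRing F n)) ∈
      wordToPoly '' (K : Set (Word F m n)) := by
    rw [h.code_eq, SetLike.mem_coe]
    refine (mem_span_generators_iff h2 h.iota_dvd _ 0).2 fun j => ?_
    rw [map_ofComponents h2, Polynomial.map_zero]
    rcases eq_or_ne j i with rfl | hj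
    · refine ⟨w, by simp, by simpa using hw⟩
    · rw [Pi.single_eq_of_ne hj]
      exact memCode_zero _ _ _ _
  have h3 : toCyclic m (ofComponents (Pi.single i (w * ℓ i))) ∈
      (Ideal.span {toCyclic m (ofComponents ι)} : Set (CyclicRing F m)) := h.kernel_eq ▸ h1
  obtain ⟨U, hU⟩ := Ideal.mem_span_singleton'.1 h3
  obtain ⟨U, rfl⟩ := Ideal.Quotient.mk_surjective U
  rw [← map_mul, eq_comm, toCyclic_eq_iff h2] at hU
  have h4 := (h.iota_dvd i).trans (hU i)
  rw [Polynomial.map_mul, map_ofComponents h2, map_ofComponents h2, Pi.single_eq_same] at h4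
  exact (dvd_sub_left (dvd_mul_left _ _)).1 h4

/-- An inner product is only one coefficient of the orthogonality polynomial. The code is closed
under polynomial multiples in each component separately, so all coefficients vanish. -/
theorem IsGeneratedBy.mem_dualCode_iff (h2 : (2 : F) ≠ 0) (hm : 0 < m) (hn : 0 < n)
    (h : IsGeneratedBy K ι ℓ θ) (d : Word F m n) :
    d ∈ dualCode K ↔ ∀ i a b, MemCode n (ι i) (ℓ i) (θ i) a b →
      CyclicOrthogonal m n (blockPoly i d.1) (blockPoly i d.2) a b := by
  have hl : 0 < Nat.lcm m n := Nat.lcm_pos hm hn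
  change (∀ c ∈ K, innerProd d c = 0) ↔ _
  constructor
  · intro hd i a b hab
    have key : ∀ p : F[X], cyclicCoeff F (Nat.lcm m n) (expand F (Nat.lcm m n - 1) p *
        (blockPoly i d.1 * expand F (Nat.lcm m n - 1) a * cyclicCofactor F m (Nat.lcm m n) +
          blockPoly i d.2 * expand F (Nat.lcm m n - 1) b * cyclicCofactor F n (Nat.lcm m n)))
        = 0 := by
      intro p
      obtain ⟨c1, hc1⟩ := exists_block h2 hm (Pi.single i (p * a))
      obtain ⟨c2, hc2⟩ := exists_block h2 hn (Pi.single i (p * b))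
      have hc : (c1, c2) ∈ K := by
        rw [h.mem_iff h2 hm hn]
        intro j
        refine MemCode.congr ?_ ((h.iota_dvd j).trans (hc1 j)) (hc2 j)
        rcases eq_or_ne j i with rfl | hj
        · simpa using hab.mul_left p
        · simpa [Pi.single_eq_of_ne hj] using memCode_zero _ _ _ _
      have h3 := congrArg (component F i) (hd _ hc)
      rw [component_innerProd hm hn, map_zero] at h3
      rw [← h3]
      refine cyclicCoeff_eq_of_dvd_sub hl ?_
      have h4 := hc1 i
      have h5 := hc2 i
      rw [Pi.single_eq_same] at h4 h5
      have h6 := X_pow_sub_one_dvd_mul_cyclicCofactor (Nat.dvd_lcm_left m n)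
        ((X_pow_sub_one_dvd_expand (Nat.lcm m n - 1) h4).mul_left (blockPoly i d.1))
      have h7 := X_pow_sub_one_dvd_mul_cyclicCofactor (Nat.dvd_lcm_right m n)
        ((X_pow_sub_one_dvd_expand (Nat.lcm m n - 1) h5).mul_left (blockPoly i d.2))
      convert dvd_add h6 h7 using 1
      simp only [map_sub, map_mul]
      ring
    refine dvd_of_cyclicCoeff_eq_zero hl fun k => ?_
    -- Since `(l - 1)^2 ≡ 1` modulo `l`, substituting `1/x` in this multiplier gives back `x^k`.
    rw [← key (X ^ ((Nat.lcm m n - 1) * k))]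
    refine cyclicCoeff_eq_of_dvd_sub hl ?_
    rw [← sub_mul, map_pow, expand_X, ← pow_mul]
    refine Dvd.dvd.mul_right ?_ _
    generalize Nat.lcm m n = l at hl
    obtain ⟨s, rfl⟩ := Nat.exists_eq_add_of_le' hl
    rw [Nat.add_sub_cancel]
    rcases s with _ | s
    · simpa using X_pow_sub_one_dvd (F := F) (dvd_mul_right 1 k)
    · have : (X ^ k - X ^ ((s + 1) * ((s + 1) * k)) : F[X]) =
          -(X ^ k * (X ^ ((s + 1 + 1) * (s * k)) - 1)) := by ring
      rw [this, dvd_neg]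
      exact (X_pow_sub_one_dvd (dvd_mul_right _ _)).mul_left _
  · intro hd c hc
    refine component_ext h2 fun i => ?_
    rw [component_innerProd hm hn, map_zero]
    have h3 := hd i _ _ ((h.mem_iff h2 hm hn c).1 hc i)
    unfold CyclicOrthogonal at h3
    rw [cyclicCoeff_eq_of_dvd_sub hl (g := 0) (by rwa [sub_zero]), map_zero]

/-- Separability puts `(0 | θ)` in the code, hence also `(ℓ | 0)`, and the kernel condition applies.
-/
theorem IsGeneratedBy.iota_dvd_ell_of_isSeparableCode (h2 : (2 : F) ≠ 0) (hm : 0 < m) (hn : 0 < n)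
    (h : IsGeneratedBy K ι ℓ θ) (hs : IsSeparableCode K) (i : Fin 3) : ι i ∣ ℓ i := by
  obtain ⟨c1, hc1⟩ := exists_block h2 hm ℓ
  obtain ⟨c2, hc2⟩ := exists_block h2 hn θ
  have hc : (c1, c2) ∈ K := (h.mem_iff h2 hm hn _).2 fun j =>
    MemCode.congr ⟨1, by simp⟩ ((h.iota_dvd j).trans (hc1 j)) (hc2 j)
  have h0 : ((0, c2) : Word F m n) ∈ K := by
    rw [hs]
    exact ⟨⟨0, K.zero_mem, rfl⟩, ⟨_, hc, rfl⟩⟩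
  obtain ⟨w, hw1, hw2⟩ := (h.mem_iff h2 hm hn _).1 h0 i
  have h3 := h.iota_dvd_of_dvd h2 i (1 - w) (by
    convert dvd_add hw2 (hc2 i) using 1
    ring)
  have h4 : blockPoly i (0 : Fin m → CoeffRing F) = 0 := by simp [blockPoly]
  rw [h4] at hw1
  convert dvd_sub h3 hw1 using 1
  ring

/-- Words supported in the single component `i` isolate that component of the duality. -/
theorem IsGeneratedBy.memCode_dual_iff (h2 : (2 : F) ≠ 0) (hm : 0 < m) (hn : 0 < n)
    (h : IsGeneratedBy K ι ℓ θ) {ι' ℓ' θ' : Fin 3 → F[X]}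
    (h' : IsGeneratedBy (dualCode K) ι' ℓ' θ') (i : Fin 3) (a b : F[X]) :
    MemCode n (ι' i) (ℓ' i) (θ' i) a b ↔
      ∀ c d, MemCode n (ι i) (ℓ i) (θ i) c d → CyclicOrthogonal m n a b c d := by
  obtain ⟨x, hx⟩ := exists_block h2 hm (Pi.single i a)
  obtain ⟨y, hy⟩ := exists_block h2 hn (Pi.single i b)
  have hxi := hx i
  have hyi := hy i
  rw [Pi.single_eq_same] at hxi hyi
  have h1 := h'.mem_iff h2 hm hn (x, y)
  rw [h.mem_dualCode_iff h2 hm hn] at h1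
  constructor
  · intro hab c d hcd
    refine CyclicOrthogonal.congr_left (h1.2 (fun j => ?_) i c d hcd)
      (by rw [dvd_sub_comm]; exact hxi) (by rw [dvd_sub_comm]; exact hyi)
    refine MemCode.congr ?_ ((h'.iota_dvd j).trans (hx j)) (hy j)
    rcases eq_or_ne j i with rfl | hj
    · simpa using hab
    · simpa [Pi.single_eq_of_ne hj] using memCode_zero _ _ _ _
  · intro hab
    refine MemCode.congr (h1.1 (fun j c d hcd => ?_) i)
      (by rw [dvd_sub_comm]; exact (h'.iota_dvd i).trans hxi) (by rw [dvd_sub_comm]; exact hyi)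
    refine CyclicOrthogonal.congr_left ?_ (hx j) (hy j)
    rcases eq_or_ne j i with rfl | hj
    · simpa using hab c d hcd
    · simp [Pi.single_eq_of_ne hj, CyclicOrthogonal]

end Codes

end DoubleCyclic

/-! ### Assembling the three components. -/

theorem theorem2 {F : Type*} [Field F] [Finite F] (hF : ringChar F ≠ 2)
    (m n : ℕ) (hm : 0 < m) (hn : 0 < n)
    (K : Submodule (CoeffRing F) (Word F m n)) (hK : IsDoubleCyclic K)
    (ι ℓ θ : Fin 3 → F[X]) (hgen : IsGeneratedBy K ι ℓ θ)
    (ι' ℓ' θ' : Fin 3 → F[X]) (hgen' : IsGeneratedBy (dualCode K) ι' ℓ' θ')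
    (hnorm' : IsNormalized ι' ℓ' θ') :
    -- (1)
    ((∀ i, gcdRecip (ι i) (ℓ i) ∣ X ^ m - 1) ∧
      ofComponents ι' = ofComponents fun i => (X ^ m - 1) / gcdRecip (ι i) (ℓ i)) ∧
    -- (2)
    ((∀ i, recip (ι i) * recip (θ i) ∣ (X ^ n - 1) * gcdRecip (ι i) (ℓ i)) ∧
      ofComponents θ' = ofComponents fun i =>
        ((X ^ n - 1) * gcdRecip (ι i) (ℓ i)) / (recip (ι i) * recip (θ i))) ∧
    -- (3)
    ((∀ i, recip (ι i) ∣ X ^ m - 1) ∧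
      ∃ ρ : Fin 3 → F[X],
        (ofComponents ℓ' =
          ofComponents ρ * ofComponents fun i => (X ^ m - 1) / recip (ι i)) ∧
        (IsSeparableCode K → ρ = 0) ∧
        (¬ IsSeparableCode K → ∀ i,
          gcdRecip (ι i) (ℓ i) ∣ recip (ι i) ∧
          gcdRecip (ι i) (ℓ i) ∣ recip (ℓ i) ∧
          (∃ u : F[X], recip (ι i) / gcdRecip (ι i) (ℓ i) ∣
            recip (ℓ i) / gcdRecip (ι i) (ℓ i) * u - 1) ∧
          ∀ u : F[X], recip (ι i) / gcdRecip (ι i) (ℓ i) ∣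
              recip (ℓ i) / gcdRecip (ι i) (ℓ i) * u - 1 →
            ρ i = (-C ((θ i).trailingCoeff / (ℓ i).trailingCoeff) *
                X ^ (Nat.lcm m n - (θ i).natDegree + (ℓ i).natDegree) * u) %
              (recip (ι i) / gcdRecip (ι i) (ℓ i)))) := by

  have h2 : (2 : F) ≠ 0 := Ring.two_ne_zero hF
  have key := fun i => dual_generators hm hn (hgen.iota_dvd i) (hgen.theta_dvd i)
    (hgen.iota_dvd_of_dvd h2 i) (hgen'.theta_dvd i) (hgen'.iota_dvd_of_dvd h2 i)
    (hnorm'.iota_monic i) (hnorm'.theta_monic i) (hnorm'.degree_lt i)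
    (hgen.memCode_dual_iff h2 hm hn hgen' i)
  choose hι hθ hι0 ρ hρ hρ0 hρu using key
  refine ⟨⟨fun i => (hι i).1, congrArg ofComponents (funext fun i => (hι i).2)⟩,
    ⟨fun i => (hθ i).1, congrArg ofComponents (funext fun i => (hθ i).2)⟩,
    hι0, ρ, ?_, fun hs => ?_, fun _ => hρu⟩
  · refine map_component_ext h2 fun i => ?_
    rw [Polynomial.map_mul, map_ofComponents h2, map_ofComponents h2, map_ofComponents h2]
    exact hρ i
  · exact funext fun i => hρ0 i (hgen.iota_dvd_ell_of_isSeparableCode h2 hm hn hs i)
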